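/- Let $n,m\ge 0$ and $N\ge 1$ be integers, let $k_1,\dots,k_m\ge 2$ be integers, and put $k=k_1+\dots+k_m-m$. For $s\ge2$ let $\mathbb C(s)=\{z\in\{0,1\}^{s-1}:\sum_j z_j\le 1\}$, and let $\mathbb C=\mathbb C(k_1)\times\dots\times\mathbb C(k_m)$ and $\Xi=\mathbb R^n\times\mathbb C\times\{-1,+1\}$. Let $\|\cdot\|$ be a norm on $\mathbb R^n$ with dual norm $\|\gamma\|_*=\sup_{\|w\|\le 1}\gamma^\top w$, let $\kappa,p,\epsilon>0$ be real numbers, and define $$d_{\mathrm C}(z,z')=\Big(\sum_{j=1}^m \mathbf 1[z_j\ne z'_j]\Big)^{1/p},\qquad d(\xi,\xi')=\|x-x'\|+d_{\mathrm C}(z,z')+\kappa\,\mathbf 1[y\ne y']$$ for $\xi=(x,z,y),\ \xi'=(x',z',y')\in\Xi$. Let $\xi^i=(x^i,z^i,y^i)\in\Xi$, $i=1,\dots,N$, be a data set, let $\widehat{\mathbb P}_N=\frac1N\sum_{i=1}^N\delta_{\xi^i}$, and let $\mathfrak B_\epsilon(\widehat{\mathbb P}_N)$ be the set of all probability distributions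 $\mathbb Q$ on $\Xi$ with $\mathrm W(\mathbb Q,\widehat{\mathbb P}_N)\le\epsilon$, where $\mathrm W(\mathbb Q,\mathbb P)=\inf_\Pi\int d\,\mathrm d\Pi$, the infimum being over all probability distributions $\Pi$ on $\Xi^2$ with first marginal $\mathbb Q$ and second marginal $\mathbb P$. For $\beta=(\beta_0,\beta_{\mathrm N},\beta_{\mathrm C})\in\mathbb R^{1+n+k}$ let $$l_\beta(x,z,y)=\log\bigl(1+\exp[-y(\beta_0+\beta_{\mathrm N}^\top x+\beta_{\mathrm C}^\top z)]\bigr).$$ Let $\mathcal K_{\exp}\subset\mathbb R^3$ be the closure of $\{(a,b,c):a\ge b\,e^{c/b},\ a>0,\ b>0\}$. Then the distributionally robust logistic regression problem $$\text{(DRO)}\qquad \inf_{\beta\in\mathbb R^{1+n+k}}\ \sup_{\mathbb Q\in\mathfrak B_\epsilon(\widehat{\mathbb P}_N)}\mathbb E_{\mathbb Q}[l_\beta(x,z,y)]$$ is equivalent to the following problem (ECP): minimize $\lambda\epsilon+\frac1N\sum_{i=1}^N s_i$ over $\beta\in\mathbb R^{1+n+k}$, $\lambda\ge0$, $s\in\mathbb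 R^N$ and $u^{\pm}_{i,z},v^{\pm}_{i,z}\in\mathbb R$ ($1\le i\le N$, $z\in\mathbb C$), subject to $\|\beta_{\mathrm N}\|_*\le\lambda$ and, for all $i$ and all $z\in\mathbb C$, $$\begin{aligned} &u^+_{i,z}+v^+_{i,z}\le1,\quad (u^+_{i,z},\,1,\,-s_i-\lambda d_{\mathrm C}(z,z^i))\in\mathcal K_{\exp},\\ &(v^+_{i,z},\,1,\,-y^i\beta_{\mathrm N}^\top x^i-y^i\beta_{\mathrm C}^\top z-y^i\beta_0-s_i-\lambda d_{\mathrm C}(z,z^i))\in\mathcal K_{\exp},\\ &u^-_{i,z}+v^-_{i,z}\le1,\quad (u^-_{i,z},\,1,\,-s_i-\lambda d_{\mathrm C}(z,z^i)-\lambda\kappa)\in\mathcal K_{\exp},\\ &(v^-_{i,z},\,1,\,y^i\beta_{\mathrm N}^\top x^i+y^i\beta_{\mathrm C}^\top z+y^i\beta_0-s_i-\lambda d_{\mathrm C}(z,z^i)-\lambda\kappa)\in\mathcal K_{\exp}. \end{aligned}$$ That is: the two problems have the same optimal value; for every fixed $\beta$, the supremum in (DRO) is finite and equals the minimum, which is attained,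 of (ECP) over the remaining variables; and $\beta$ is a minimizer of (DRO) if and only if it is the $\beta$-component of a minimizer of (ECP). Moreover, (ECP) is a finite-dimensional exponential conic program: it has a linear objective on a finite-dimensional space, and its feasible set is given by finitely many affine inequalities, finitely many constraints that an affine function of the variables lies in $\mathcal K_{\exp}$, and the dual-norm constraint $\|\beta_{\mathrm N}\|_*\le\lambda$. -/

import Mathlib

open MeasureTheory
open scoped ENNReal

noncomputable section

namespace MixedLogReg

/-- `ℂ(s)`: the one-hot encodings `z ∈ {0,1}^(s-1)`, `∑ z_j ≤ 1`, of a categorical feature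
with `s` possible values. -/
def oneHot (s : ℕ) : Set (Fin (s - 1) → ℝ) :=
  {z | (∀ j, z j = 0 ∨ z j = 1) ∧ ∑ j, z j ≤ 1}

/-- `ℂ = ℂ(k₁) × … × ℂ(k_m)`, the support of the categorical features. -/
abbrev Cat {m : ℕ} (k : Fin m → ℕ) : Type := (j : Fin m) → oneHot (k j)

/-- The labels `{-1, +1}`. -/
abbrev Label : Type := ({-1, 1} : Set ℝ)

/-- `Ξ = ℝⁿ × ℂ × {-1, +1}`, with its Borel σ-algebra. -/
abbrev Sample (n : ℕ) {m : ℕ} (k : Fin m → ℕ) : Type := (Fin n → ℝ) × Cat k × Label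

/-- The coefficients `β = (β₀, β_N, β_C)`, where `β_C` has one slope for each of the
`k = k₁ + … + k_m - m` coordinates of the categorical features. -/
abbrev Coef (n : ℕ) {m : ℕ} (k : Fin m → ℕ) : Type :=
  ℝ × (Fin n → ℝ) × ((j : Fin m) → Fin (k j - 1) → ℝ)

section Loss

variable {n m : ℕ} {k : Fin m → ℕ}

/-- `β_Nᵀ x`. -/
def numDot (β : Coef n k) (x : Fin n → ℝ) : ℝ := ∑ l, β.2.1 l * x l

/-- `β_Cᵀ z`. -/
def catDot (β : Coef n k) (z : Cat k) : ℝ := ∑ j, ∑ l, β.2.2 j l * (z j).1 l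

/-- The log-loss `l_β(x, z, y)`. -/
def logLoss (β : Coef n k) : Sample n k → ℝ
  | (x, z, y) => Real.log (1 + Real.exp (-y.1 * (β.1 + numDot β x + catDot β z)))

end Loss

section Metric

variable {n m : ℕ} {k : Fin m → ℕ}

open Classical in
/-- `d_C(z, z')`: the number of features in which `z` and `z'` differ, to the power `1/p`. -/
def catDist (p : ℝ) (z z' : Cat k) : ℝ :=
  (∑ j, if z j ≠ z' j then (1 : ℝ) else 0) ^ (1 / p)

open Classical in
/-- The ground metric on `Ξ`. -/
def groundDist (nrm : Seminorm ℝ (Fin n → ℝ)) (κ p : ℝ) : Sample n k → Sample n k → ℝ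
  | (x, z, y), (x', z', y') =>
      nrm (x - x') + catDist p z z' + κ * (if y ≠ y' then 1 else 0)

/-- The dual norm `‖γ‖_* = sup {γᵀ w : ‖w‖ ≤ 1}`. -/
def dualNorm (nrm : Seminorm ℝ (Fin n → ℝ)) (γ : Fin n → ℝ) : ℝ :=
  sSup {r | ∃ w, nrm w ≤ 1 ∧ r = ∑ l, γ l * w l}

end Metric

section Transport

/-- The type-1 Wasserstein distance with ground cost `d`. -/
def wasserstein {Ξ : Type*} [MeasurableSpace Ξ] (d : Ξ → Ξ → ℝ) (Q P : Measure Ξ) : ℝ≥0∞ :=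
  ⨅ (c : Measure (Ξ × Ξ)) (_ : IsProbabilityMeasure c ∧ c.map Prod.fst = Q ∧ c.map Prod.snd = P),
    ∫⁻ q, ENNReal.ofReal (d q.1 q.2) ∂c

/-- The empirical distribution of a data set. -/
def empirical {Ξ : Type*} [MeasurableSpace Ξ] {N : ℕ} (ξ : Fin N → Ξ) : Measure Ξ :=
  (N : ℝ≥0∞)⁻¹ • ∑ i, Measure.dirac (ξ i)

/-- The Wasserstein ball of radius `ε` around `P`. -/
def ambiguitySet {Ξ : Type*} [MeasurableSpace Ξ] (d : Ξ → Ξ → ℝ) (P : Measure Ξ) (ε : ℝ) :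
    Set (Measure Ξ) :=
  {Q | IsProbabilityMeasure Q ∧ wasserstein d Q P ≤ ENNReal.ofReal ε}

end Transport

section Problems

variable {n m N : ℕ} {k : Fin m → ℕ}

/-- The worst-case expected log-loss of `β` over the ambiguity set. The log-loss is positive, so
its expectation is a well-defined element of `[0, ∞]`. -/
def worstCase (nrm : Seminorm ℝ (Fin n → ℝ)) (κ p ε : ℝ) (ξ : Fin N → Sample n k)
    (β : Coef n k) : ℝ≥0∞ :=
  ⨆ Q ∈ ambiguitySet (groundDist nrm κ p) (empirical ξ) ε,
    ∫⁻ ζ, ENNReal.ofReal (logLoss β ζ) ∂Q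

/-- `K_exp`, the exponential cone. -/
def expCone : Set (ℝ × ℝ × ℝ) :=
  closure {w | w.1 ≥ w.2.1 * Real.exp (w.2.2 / w.2.1) ∧ 0 < w.1 ∧ 0 < w.2.1}

/-- The decision variables `(β, λ, s, u⁺, v⁺, u⁻, v⁻)` of the conic program. -/
abbrev Decision (n : ℕ) {m : ℕ} (k : Fin m → ℕ) (N : ℕ) : Type :=
  Coef n k × ℝ × (Fin N → ℝ) ×
    (Fin N → Cat k → ℝ) × (Fin N → Cat k → ℝ) × (Fin N → Cat k → ℝ) × (Fin N → Cat k → ℝ)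

/-- The objective `λ ε + (1/N) ∑ s_i`. -/
def objective (ε : ℝ) : Decision n k N → ℝ
  | (_, lam, s, _) => lam * ε + 1 / (N : ℝ) * ∑ i, s i

/-- The constraints of the conic program; sample `i` is `(xⁱ, zⁱ, yⁱ)`, that is
`((ξ i).1, (ξ i).2.1, (ξ i).2.2)`. -/
def Feasible (nrm : Seminorm ℝ (Fin n → ℝ)) (κ p : ℝ) (ξ : Fin N → Sample n k) :
    Decision n k N → Prop
  | (β, lam, s, up, vp, um, vm) =>
    (∀ (i : Fin N) (z : Cat k),
      let x := (ξ i).1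
      let y : ℝ := (ξ i).2.2
      let δ := catDist p z (ξ i).2.1
      up i z + vp i z ≤ 1 ∧
      (up i z, 1, -s i - lam * δ) ∈ expCone ∧
      (vp i z, 1, -y * numDot β x - y * catDot β z - y * β.1 - s i - lam * δ) ∈ expCone) ∧
    (∀ (i : Fin N) (z : Cat k),
      let x := (ξ i).1
      let y : ℝ := (ξ i).2.2
      let δ := catDist p z (ξ i).2.1
      um i z + vm i z ≤ 1 ∧
      (um i z, 1, -s i - lam * δ - lam * κ) ∈ expCone ∧
      (vm i z, 1, y * numDot β x + y * catDot β z + y * β.1 - s i - lam * δ - lam * κ)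
        ∈ expCone) ∧
    dualNorm nrm β.2.1 ≤ lam ∧
    0 ≤ lam

/-- Minimizing `f` over `S` is a finite-dimensional exponential conic program (with an additional
constraint in the cone of the dual norm): the variables range over a finite-dimensional space, the
objective is linear, and `S` is cut out by finitely many affine inequalities, finitely many
memberships of affine images in `K_exp`, and one constraint `‖g x‖_* ≤ h x` with linear
`g` and `h`. -/
def IsExpConicProgram (nrm : Seminorm ℝ (Fin n → ℝ)) {V : Type} [AddCommGroup V] [Module ℝ V]
    (f : V → ℝ) (S : Set V) : Prop :=
  FiniteDimensional ℝ V ∧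
  (∃ c : V →ₗ[ℝ] ℝ, ∀ x, f x = c x) ∧
  ∃ (I J : Type) (_ : Finite I) (_ : Finite J)
    (a : I → V →ᵃ[ℝ] ℝ) (b : J → V →ᵃ[ℝ] (ℝ × ℝ × ℝ))
    (g : V →ₗ[ℝ] (Fin n → ℝ)) (h : V →ₗ[ℝ] ℝ),
    S = {x | (∀ i, a i x ≤ 0) ∧ (∀ j, b j x ∈ expCone) ∧ dualNorm nrm (g x) ≤ h x}

end Problems

end MixedLogReg

end

/-! ### Exponential cone, dual norm, and convexity tools on the real line and in the plane. -/

namespace MixedLogReg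

/-! Fix `β`. The log-loss is Lipschitz in `x` with constant `‖β_N‖_*`. So if `‖β_N‖_* ≤ λ`, moving
the numerical features never pays for itself, and the dual constraint on `s_i` need only be tested
at `x = xⁱ` and the finitely many `(z, y)`. This is `EpigraphFeasible`; integrating against a
coupling gives weak duality (`worstCase_le_of_epigraphFeasible`).

Strong duality is planar. Each way of moving the `N` atoms gives a point (mean cost, mean loss), and
a mixture of two such points with cost at most `ε` comes from a measure in the ball, so its loss is
at most the worst case. Since `ε > 0` and not moving costs nothing, `exists_supporting_slope` gives
a multiplier `λ`. The atoms move independently, so the Lagrangian bound splits into one supremum per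
sample, which serves as `s_i`. Its finiteness along rays in `x` forces `‖β_N‖_* ≤ λ`.

Finally `log (1 + exp a) - t ≤ s` means `exp (-s - t) + exp (a - s - t) ≤ 1`, which the variables
`u`, `v` express through two exponential cones. -/

/-- The defining inequality is continuous near `b = 1`, so taking the closure adds no points on this
slice. -/
theorem mem_expCone_one_iff (a c : ℝ) : (a, (1 : ℝ), c) ∈ expCone ↔ Real.exp c ≤ a := by
  constructor
  · intro h
    obtain ⟨u, hu, hlim⟩ := mem_closure_iff_seq_limit.1 h
    have h1 : ContinuousAt
        (fun w : ℝ × ℝ × ℝ => w.1 - w.2.1 * Real.exp (w.2.2 / w.2.1)) (a, 1, c) := by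
      have : ContinuousAt (fun w : ℝ × ℝ × ℝ => w.2.2 / w.2.1) (a, 1, c) :=
        ContinuousAt.div (by fun_prop) (by fun_prop) (by simp)
      have h2 := Real.continuous_exp.continuousAt.comp this
      exact ContinuousAt.sub (by fun_prop) (ContinuousAt.mul (by fun_prop) h2)
    have h3 := h1.tendsto.comp hlim
    have h4 := ge_of_tendsto' h3 (b := 0) fun n => by
      have := (hu n).1
      simp only [Function.comp]
      linarith
    simp at h4
    exact h4
  · intro h
    refine subset_closure ⟨?_, (Real.exp_pos c).trans_le h, one_pos⟩
    simpa using h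

/-- A definite seminorm on a finite-dimensional space dominates every linear functional. -/
theorem exists_le_mul_seminorm {V : Type*} [AddCommGroup V] [Module ℝ V] [FiniteDimensional ℝ V]
    (q : Seminorm ℝ V) (hq : ∀ x, q x = 0 → x = 0) (f : V →ₗ[ℝ] ℝ) :
    ∃ C, ∀ w, f w ≤ C * q w := by
  let : NormedAddCommGroup V := AddGroupNorm.toNormedAddCommGroup
    { q.toAddGroupSeminorm with eq_zero_of_map_eq_zero' := hq }
  let : NormedSpace ℝ V := ⟨fun a b => (map_smul_eq_mul q a b).le⟩
  refine ⟨‖LinearMap.toContinuousLinearMap f‖, fun w => ?_⟩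
  exact (le_abs_self _).trans ((LinearMap.toContinuousLinearMap f).le_opNorm w)

/-- Rescale `w` to norm one. Definiteness bounds the set in `dualNorm`, so that its `sSup` is a true
supremum and not the default `0`. -/
theorem dualNorm_le_iff {n : ℕ} (nrm : Seminorm ℝ (Fin n → ℝ)) (hnrm : ∀ x, nrm x = 0 → x = 0)
    (γ : Fin n → ℝ) (lam : ℝ) (hlam : 0 ≤ lam) :
    dualNorm nrm γ ≤ lam ↔ ∀ w, ∑ l, γ l * w l ≤ lam * nrm w := by
  constructor
  · intro h w
    obtain ⟨C, hC⟩ := exists_le_mul_seminorm nrm hnrm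
      (IsLinearMap.mk' (fun w : Fin n → ℝ => ∑ l, γ l * w l)
        ⟨fun x y => by simp [mul_add, Finset.sum_add_distrib], fun c x => by
          simp [Finset.mul_sum, mul_left_comm]⟩)
    simp only [IsLinearMap.mk'_apply] at hC
    rcases (apply_nonneg nrm w).eq_or_lt' with h0 | h0
    · simp [hnrm w h0]
    have hb : BddAbove {r | ∃ w, nrm w ≤ 1 ∧ r = ∑ l, γ l * w l} := by
      refine ⟨|C|, ?_⟩
      rintro r ⟨w, hw, rfl⟩
      refine (hC w).trans ((mul_le_mul_of_nonneg_right (le_abs_self C) (apply_nonneg _ _)).trans ?_)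
      exact mul_le_of_le_one_right (abs_nonneg C) hw
    have h1 : ∑ l, γ l * ((nrm w)⁻¹ • w) l ≤ lam := by
      refine (le_csSup hb ⟨(nrm w)⁻¹ • w, ?_, rfl⟩).trans h
      rw [map_smul_eq_mul, Real.norm_of_nonneg (inv_nonneg.2 h0.le), inv_mul_cancel₀ h0.ne']
    have h2 : ∑ l, γ l * ((nrm w)⁻¹ • w) l = (∑ l, γ l * w l) / nrm w := by
      simp only [Pi.smul_apply, smul_eq_mul, Finset.sum_div]
      exact Finset.sum_congr rfl fun l _ => by field_simp
    rwa [h2, div_le_iff₀ h0] at h1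
  · intro h
    refine csSup_le ⟨0, 0, by simp, by simp⟩ ?_
    rintro r ⟨w, hw, rfl⟩
    exact (h w).trans (mul_le_of_le_one_right hlam hw)

theorem log_one_add_exp_le {a b t : ℝ} (ht : 0 ≤ t) (h : b ≤ a + t) :
    Real.log (1 + Real.exp b) ≤ Real.log (1 + Real.exp a) + t := by
  rw [show t = Real.log (Real.exp t) from (Real.log_exp t).symm,
    ← Real.log_mul (by positivity) (by positivity)]
  refine Real.log_le_log (by positivity) ?_
  have h1 : Real.exp b ≤ Real.exp a * Real.exp t := by
    rw [← Real.exp_add]; exact Real.exp_le_exp.2 h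
  have h2 := Real.one_le_exp ht
  linarith

theorem le_log_one_add_exp (a : ℝ) : a ≤ Real.log (1 + Real.exp a) := by
  rw [Real.le_log_iff_exp_le (by positivity)]
  linarith

/-- `log (1 + exp a) - t ≤ s` in the exponential-cone form used by the conic program. -/
theorem exists_add_le_one_iff (a t s : ℝ) :
    (∃ u v : ℝ, u + v ≤ 1 ∧ Real.exp (-s - t) ≤ u ∧ Real.exp (a - s - t) ≤ v) ↔
      Real.log (1 + Real.exp a) - t ≤ s := by
  have key : Real.exp (-s - t) + Real.exp (a - s - t) ≤ 1 ↔
      Real.log (1 + Real.exp a) - t ≤ s := by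
    rw [sub_le_iff_le_add, Real.log_le_iff_le_exp (by positivity)]
    have h1 : Real.exp (-s - t) + Real.exp (a - s - t)
        = (1 + Real.exp a) / Real.exp (s + t) := by
      rw [add_div, ← Real.exp_sub, one_div, ← Real.exp_neg]
      ring_nf
    rw [h1, div_le_one (Real.exp_pos _)]
  rw [← key]
  constructor
  · rintro ⟨u, v, h, hu, hv⟩
    linarith
  · intro h
    exact ⟨_, _, h, le_rfl, le_rfl⟩

/-- Supporting line at `ε` of a planar set whose chords stay below `M` on the left of `ε`. -/
theorem exists_supporting_slope (B : Set (ℝ × ℝ)) (ε M : ℝ)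
    (hmix : ∀ a ∈ B, ∀ b ∈ B, ∀ θ : ℝ, 0 ≤ θ → θ ≤ 1 →
      (1 - θ) * a.1 + θ * b.1 ≤ ε → (1 - θ) * a.2 + θ * b.2 ≤ M)
    (h0 : ∃ a ∈ B, a.1 < ε) :
    ∃ lam : ℝ, 0 ≤ lam ∧ ∀ a ∈ B, a.2 ≤ M + lam * (a.1 - ε) := by
  -- Slopes from `(ε, M)` to the points right of `ε`; the inserted `0` makes the supremum
  -- nonnegative. Every point left of `ε` gives an upper bound.
  set T : Set ℝ := insert 0 {r | ∃ b ∈ B, ε < b.1 ∧ r = (b.2 - M) / (b.1 - ε)} with hT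
  have hle : ∀ a ∈ B, a.1 ≤ ε → a.2 ≤ M := fun a ha h => by
    have := hmix a ha a ha 0 le_rfl zero_le_one (by linarith)
    linarith
  have hub : ∀ a ∈ B, a.1 < ε → (M - a.2) / (ε - a.1) ∈ upperBounds T := by
    rintro a ha hlt r (rfl | ⟨b, hb, hlt', rfl⟩)
    · exact div_nonneg (sub_nonneg.2 (hle a ha hlt.le)) (sub_nonneg.2 hlt.le)
    · have hpos : 0 < b.1 - a.1 := by linarith
      -- This weight puts the mixed first coordinate exactly at `ε`.
      have h := hmix a ha b hb ((ε - a.1) / (b.1 - a.1)) (div_nonneg (by linarith) hpos.le)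
        ((div_le_one hpos).2 (by linarith)) (le_of_eq (by field_simp; ring))
      rw [div_le_div_iff₀ (by linarith) (by linarith)]
      have h' : (1 - (ε - a.1) / (b.1 - a.1)) * a.2 + (ε - a.1) / (b.1 - a.1) * b.2
          = ((b.1 - ε) * a.2 + (ε - a.1) * b.2) / (b.1 - a.1) := by field_simp; ring
      rw [h', div_le_iff₀ hpos] at h
      linarith
  obtain ⟨a₀, ha₀, hlt₀⟩ := h0
  have hbdd : BddAbove T := ⟨_, hub a₀ ha₀ hlt₀⟩
  refine ⟨sSup T, le_csSup hbdd (Set.mem_insert _ _), fun a ha => ?_⟩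
  rcases lt_trichotomy a.1 ε with h | h | h
  · have := csSup_le ⟨0, Set.mem_insert _ _⟩ (hub a ha h)
    rw [le_div_iff₀ (by linarith)] at this
    linarith
  · have := hle a ha h.le
    rw [h]
    linarith
  · have : (a.2 - M) / (a.1 - ε) ≤ sSup T :=
      le_csSup hbdd (Set.mem_insert_of_mem _ ⟨a, ha, h, rfl⟩)
    rw [div_le_iff₀ (by linarith)] at this
    linarith

/-- If every selection from bounded-above families has sum at most `M`, then so do the suprema. -/
theorem sum_ciSup_le {ι X : Type*} [Fintype ι] [Nonempty X] (f : ι → X → ℝ) (M : ℝ)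
    (h : ∀ c : ι → X, ∑ i, f i (c i) ≤ M) : ∑ i, ⨆ x, f i x ≤ M := by
  refine le_of_forall_pos_le_add fun δ hδ => ?_
  have hc : ∀ i, ∃ x, (⨆ x, f i x) - δ / (Fintype.card ι + 1) < f i x := fun i =>
    exists_lt_of_lt_ciSup (sub_lt_self _ (by positivity))
  choose c hc using hc
  have h1 := Finset.sum_le_sum fun i (_ : i ∈ Finset.univ) => (hc i).le
  rw [Finset.sum_sub_distrib, Finset.sum_const, Finset.card_univ, nsmul_eq_mul] at h1
  have h2 : (Fintype.card ι : ℝ) * (δ / (Fintype.card ι + 1)) ≤ δ := by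
    rw [← mul_div_assoc, div_le_iff₀ (by positivity)]
    nlinarith
  linarith [h c]

/-- Vary one entry of the reference selection `c₀` and keep the others. -/
theorem bddAbove_of_sum_le {ι X : Type*} [Fintype ι] (f : ι → X → ℝ) (M : ℝ)
    (h : ∀ c : ι → X, ∑ i, f i (c i) ≤ M) (c₀ : ι → X) (i : ι) : BddAbove (Set.range (f i)) := by
  classical
  refine ⟨M - ∑ j ∈ Finset.univ.erase i, f j (c₀ j), ?_⟩
  rintro _ ⟨x, rfl⟩
  have h1 := h (Function.update c₀ i x)
  rw [← Finset.add_sum_erase _ _ (Finset.mem_univ i), Function.update_self,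
    Finset.sum_congr rfl fun j hj => by
      rw [Function.update_of_ne (Finset.ne_of_mem_erase hj)]] at h1
  linarith

end MixedLogReg

/-! ### Empirical measures, their mixtures, and weak duality. -/

namespace MixedLogReg

section Empirical

variable {Ξ : Type*} [MeasurableSpace Ξ] {N : ℕ}

theorem lintegral_empirical [MeasurableSingletonClass Ξ] (c : Fin N → Ξ) (f : Ξ → ℝ≥0∞) :
    ∫⁻ ζ, f ζ ∂(empirical c) = (N : ℝ≥0∞)⁻¹ * ∑ i, f (c i) := by
  rw [empirical, lintegral_smul_measure, lintegral_finsetSum_measure]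
  simp [lintegral_dirac]

theorem lintegral_empirical_ofReal [MeasurableSingletonClass Ξ] (hN : 0 < N) (c : Fin N → Ξ)
    (f : Ξ → ℝ) (hf : ∀ ζ, 0 ≤ f ζ) :
    ∫⁻ ζ, ENNReal.ofReal (f ζ) ∂(empirical c) = ENNReal.ofReal (1 / (N : ℝ) * ∑ i, f (c i)) := by
  rw [lintegral_empirical, ENNReal.ofReal_mul (by positivity),
    ENNReal.ofReal_sum_of_nonneg fun i _ => hf _, one_div,
    ENNReal.ofReal_inv_of_pos (by exact_mod_cast hN), ENNReal.ofReal_natCast]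

theorem map_empirical {Ψ : Type*} [MeasurableSpace Ψ] (c : Fin N → Ξ) (g : Ξ → Ψ)
    (hg : Measurable g) : (empirical c).map g = empirical fun i => g (c i) := by
  rw [empirical, empirical, Measure.map_smul, Measure.map_finset_sum hg.aemeasurable]
  simp [Measure.map_dirac' hg]

theorem isProbabilityMeasure_empirical (hN : 0 < N) (c : Fin N → Ξ) :
    IsProbabilityMeasure (empirical c) := by
  constructor
  simp only [empirical, Measure.smul_apply, Measure.coe_finsetSum, Finset.sum_apply,
    measure_univ, smul_eq_mul, Finset.sum_const, Finset.card_univ, Fintype.card_fin, nsmul_eq_mul,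
    mul_one]
  exact ENNReal.inv_mul_cancel (by exact_mod_cast hN.ne') (ENNReal.natCast_ne_top N)

/-- Moving the atoms of a data set to a mixture of two other data sets. -/
theorem mixture_mem_ambiguitySet [MeasurableSingletonClass Ξ] (hN : 0 < N) (d : Ξ → Ξ → ℝ)
    (hd : ∀ ζ ζ', 0 ≤ d ζ ζ') (ξ a b : Fin N → Ξ) (ε θ : ℝ) (h0 : 0 ≤ θ) (h1 : θ ≤ 1)
    (h : (1 - θ) * (1 / (N : ℝ) * ∑ i, d (a i) (ξ i)) + θ * (1 / (N : ℝ) * ∑ i, d (b i) (ξ i))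
      ≤ ε) :
    ENNReal.ofReal (1 - θ) • empirical a + ENNReal.ofReal θ • empirical b ∈
      ambiguitySet d (empirical ξ) ε := by
  have hw : ENNReal.ofReal (1 - θ) + ENNReal.ofReal θ = 1 := by
    rw [← ENNReal.ofReal_add (by linarith) h0]; simp
  have hprob : ∀ {Ψ : Type _} [MeasurableSpace Ψ] (a b : Fin N → Ψ),
      IsProbabilityMeasure (ENNReal.ofReal (1 - θ) • empirical a +
        ENNReal.ofReal θ • empirical b) := by
    intro Ψ _ a b
    have ha := isProbabilityMeasure_empirical hN a
    have hb := isProbabilityMeasure_empirical hN b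
    constructor
    simp [hw]
  refine ⟨hprob a b, ?_⟩
  -- The coupling pairs each moved atom with its origin; the second marginals recombine because the
  -- weights sum to one.
  refine iInf₂_le_of_le (ENNReal.ofReal (1 - θ) • empirical (fun i => (a i, ξ i)) +
    ENNReal.ofReal θ • empirical (fun i => (b i, ξ i))) ⟨hprob _ _, ?_, ?_⟩ ?_
  · rw [Measure.map_add _ _ measurable_fst, Measure.map_smul, Measure.map_smul,
      map_empirical _ _ measurable_fst, map_empirical _ _ measurable_fst]
  · rw [Measure.map_add _ _ measurable_snd, Measure.map_smul, Measure.map_smul,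
      map_empirical _ _ measurable_snd, map_empirical _ _ measurable_snd, ← add_smul, hw, one_smul]
  · have hs : ∀ c : Fin N → Ξ, 0 ≤ 1 / (N : ℝ) * ∑ i, d (c i) (ξ i) := fun c =>
      mul_nonneg (by positivity) (Finset.sum_nonneg fun i _ => hd _ _)
    rw [lintegral_add_measure, lintegral_smul_measure, lintegral_smul_measure,
      lintegral_empirical_ofReal hN _ (fun q : Ξ × Ξ => d q.1 q.2) (fun _ => hd _ _),
      lintegral_empirical_ofReal hN _ (fun q : Ξ × Ξ => d q.1 q.2) (fun _ => hd _ _),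
      smul_eq_mul, smul_eq_mul, ← ENNReal.ofReal_mul (by linarith), ← ENNReal.ofReal_mul h0,
      ← ENNReal.ofReal_add (mul_nonneg (by linarith) (hs a)) (mul_nonneg h0 (hs b))]
    exact ENNReal.ofReal_le_ofReal h

/-- Weak duality: a transport-cost majorant of the integrand bounds its worst-case expectation. -/
theorem lintegral_le_of_mem_ambiguitySet [MeasurableSingletonClass Ξ] (d : Ξ → Ξ → ℝ)
    (ξ : Fin N → Ξ) (ε lam : ℝ) (hlam : 0 ≤ lam) (f φ : Ξ → ℝ≥0∞) (hφ : Measurable φ)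
    (h : ∀ ζ ζ', f ζ ≤ φ ζ' + ENNReal.ofReal lam * ENNReal.ofReal (d ζ ζ'))
    {Q : Measure Ξ} (hQ : Q ∈ ambiguitySet d (empirical ξ) ε) :
    ∫⁻ ζ, f ζ ∂Q ≤ (N : ℝ≥0∞)⁻¹ * ∑ i, φ (ξ i) + ENNReal.ofReal lam * ENNReal.ofReal ε := by
  have key : ∀ c : Measure (Ξ × Ξ),
      IsProbabilityMeasure c ∧ c.map Prod.fst = Q ∧ c.map Prod.snd = empirical ξ →
      ∫⁻ ζ, f ζ ∂Q ≤ (N : ℝ≥0∞)⁻¹ * ∑ i, φ (ξ i) +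
        ENNReal.ofReal lam * ∫⁻ q, ENNReal.ofReal (d q.1 q.2) ∂c := by
    rintro c ⟨-, rfl, h2⟩
    -- Only an upper bound is needed, so `f` need not be measurable.
    calc ∫⁻ ζ, f ζ ∂(c.map Prod.fst) ≤ ∫⁻ q, f q.1 ∂c := lintegral_map_le _ _
      _ ≤ ∫⁻ q, (φ q.2 + ENNReal.ofReal lam * ENNReal.ofReal (d q.1 q.2)) ∂c :=
          lintegral_mono fun q => h _ _
      _ = _ := by
          rw [lintegral_add_left (show Measurable fun q : Ξ × Ξ => φ q.2 from hφ.comp measurable_snd),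
            lintegral_const_mul' _ _ ENNReal.ofReal_ne_top, ← lintegral_empirical ξ φ, ← h2,
            lintegral_map hφ measurable_snd]
  have hW := hQ.2
  -- An optimal coupling is not assumed to exist: one within `η` of the bound suffices. The `lam +
  -- 1` covers `lam = 0`.
  refine ENNReal.le_of_forall_pos_le_add fun δ hδ _ => ?_
  obtain ⟨η, hη, hη'⟩ : ∃ η : ℝ, 0 < η ∧ lam * η ≤ δ :=
    ⟨δ / (lam + 1), by positivity, by
      rw [← mul_div_assoc, div_le_iff₀ (by positivity)]; nlinarith [δ.2]⟩
  have hlt : wasserstein d Q (empirical ξ) < ENNReal.ofReal ε + ENNReal.ofReal η :=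
    hW.trans_lt (ENNReal.lt_add_right ENNReal.ofReal_ne_top (by simpa using hη))
  simp only [wasserstein, iInf_lt_iff] at hlt
  obtain ⟨c, hc, hlt⟩ := hlt
  refine (key c hc).trans ?_
  rw [add_assoc]
  refine add_le_add_right ?_ _
  refine (mul_le_mul_right hlt.le _).trans ?_
  rw [mul_add, ← ENNReal.ofReal_mul hlam (q := η)]
  refine add_le_add_right ?_ _
  rw [← ENNReal.ofReal_coe_nnreal]
  exact ENNReal.ofReal_le_ofReal hη'

end Empirical

end MixedLogReg

/-! ### The log-loss, the epigraph form, and strong duality. -/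

namespace MixedLogReg

variable {n m N : ℕ} {k : Fin m → ℕ}

instance finite_oneHot (s : ℕ) : Finite (oneHot s) := by
  have h : (Set.univ.pi fun _ : Fin (s - 1) => ({0, 1} : Set ℝ)).Finite :=
    Set.Finite.pi fun _ => Set.toFinite _
  exact (h.subset fun z hz j _ => hz.1 j).to_subtype

noncomputable instance fintypeCat : Fintype (Cat k) := Fintype.ofFinite _

theorem label_eq (y : Label) : y.1 = -1 ∨ y.1 = 1 := y.2

theorem exists_label_neg (y : Label) : ∃ y' : Label, y'.1 = -y.1 ∧ y ≠ y' := by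
  rcases label_eq y with h | h
  · refine ⟨⟨1, by simp⟩, by simp [h], fun hy => ?_⟩
    rw [hy] at h
    norm_num at h
  · refine ⟨⟨-1, by simp⟩, by simp [h], fun hy => ?_⟩
    rw [hy] at h
    norm_num at h

theorem label_eq_neg_of_ne {y y' : Label} (h : y ≠ y') : y'.1 = -y.1 := by
  rcases label_eq y with h1 | h1 <;> rcases label_eq y' with h2 | h2 <;>
    first
    | exact absurd (Subtype.ext (h1.trans h2.symm)) h
    | simp [h1, h2]

theorem catDist_nonneg (p : ℝ) (z z' : Cat k) : 0 ≤ catDist p z z' :=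
  Real.rpow_nonneg (Finset.sum_nonneg fun j _ => by split_ifs <;> norm_num) _

theorem catDist_self {p : ℝ} (hp : 0 < p) (z : Cat k) : catDist p z z = 0 := by
  simp [catDist, Real.zero_rpow (inv_pos.2 hp).ne']

theorem groundDist_nonneg (nrm : Seminorm ℝ (Fin n → ℝ)) {κ : ℝ} (hκ : 0 < κ) (p : ℝ)
    (ζ ζ' : Sample n k) : 0 ≤ groundDist nrm κ p ζ ζ' := by
  obtain ⟨x, z, y⟩ := ζ
  obtain ⟨x', z', y'⟩ := ζ'
  have h1 := apply_nonneg nrm (x - x')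
  have h2 := catDist_nonneg p z z'
  simp only [groundDist]
  split_ifs <;> linarith

theorem groundDist_self (nrm : Seminorm ℝ (Fin n → ℝ)) (κ : ℝ) {p : ℝ} (hp : 0 < p)
    (ζ : Sample n k) : groundDist nrm κ p ζ ζ = 0 := by
  obtain ⟨x, z, y⟩ := ζ
  simp [groundDist, catDist_self hp]

theorem logLoss_nonneg (β : Coef n k) (ζ : Sample n k) : 0 ≤ logLoss β ζ := by
  obtain ⟨x, z, y⟩ := ζ
  exact Real.log_nonneg (by linarith [Real.exp_pos (-y.1 * (β.1 + numDot β x + catDot β z))])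

theorem continuous_logLoss_left (β : Coef n k) (z : Cat k) (y : Label) :
    Continuous fun x : Fin n → ℝ => logLoss β (x, z, y) := by
  simp only [logLoss, numDot]
  refine Continuous.log (by fun_prop) fun x => ?_
  positivity

/-- The categorical and label parts range over a countable set. -/
theorem measurable_of_measurable_left {α : Type*} [MeasurableSpace α] {f : Sample n k → α}
    (hf : ∀ z y, Measurable fun x => f (x, z, y)) : Measurable f :=
  measurable_from_prod_countable_left fun c => hf c.1 c.2

/-- Shifting the numerical features by a vector changes the log-loss by at most
`‖β_N‖_*` times its norm. -/
theorem logLoss_le_add (nrm : Seminorm ℝ (Fin n → ℝ)) (hnrm : ∀ x, nrm x = 0 → x = 0)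
    (β : Coef n k) {lam : ℝ} (hlam : 0 ≤ lam) (h : dualNorm nrm β.2.1 ≤ lam)
    (x x' : Fin n → ℝ) (z : Cat k) (y : Label) :
    logLoss β (x, z, y) ≤ logLoss β (x', z, y) + lam * nrm (x - x') := by
  have hd := (dualNorm_le_iff nrm hnrm β.2.1 lam hlam).1 h
  refine log_one_add_exp_le (mul_nonneg hlam (apply_nonneg _ _)) ?_
  have hdiff : ∀ a b : Fin n → ℝ, numDot β a - numDot β b = ∑ l, β.2.1 l * (a - b) l :=
    fun a b => by simp [numDot, mul_sub]
  rcases label_eq y with hy | hy <;> rw [hy]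
  · linarith [hd (x - x'), hdiff x x']
  · have := hd (x' - x)
    rw [map_sub_rev] at this
    linarith [hdiff x' x]

/-- The conic program in terms of the epigraph variables `λ`, `s` alone. -/
def EpigraphFeasible (nrm : Seminorm ℝ (Fin n → ℝ)) (κ p : ℝ) (ξ : Fin N → Sample n k)
    (β : Coef n k) (lam : ℝ) (s : Fin N → ℝ) : Prop :=
  dualNorm nrm β.2.1 ≤ lam ∧ 0 ≤ lam ∧
    ∀ i z y, logLoss β ((ξ i).1, z, y) - lam * groundDist nrm κ p ((ξ i).1, z, y) (ξ i) ≤ s i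

theorem logLoss_sub_groundDist_same (nrm : Seminorm ℝ (Fin n → ℝ)) (κ p : ℝ) (β : Coef n k)
    (lam : ℝ) (ζ : Sample n k) (z : Cat k) :
    logLoss β (ζ.1, z, ζ.2.2) - lam * groundDist nrm κ p (ζ.1, z, ζ.2.2) ζ =
      Real.log (1 + Real.exp (-ζ.2.2.1 * numDot β ζ.1 - ζ.2.2.1 * catDot β z - ζ.2.2.1 * β.1)) -
        lam * catDist p z ζ.2.1 := by
  obtain ⟨x, z', y⟩ := ζ
  simp only [logLoss, groundDist]
  congr 1
  · ring_nf
  · simp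

theorem logLoss_sub_groundDist_flip (nrm : Seminorm ℝ (Fin n → ℝ)) (κ p : ℝ) (β : Coef n k)
    (lam : ℝ) (ζ : Sample n k) (z : Cat k) {y : Label} (hy : ζ.2.2 ≠ y) :
    logLoss β (ζ.1, z, y) - lam * groundDist nrm κ p (ζ.1, z, y) ζ =
      Real.log (1 + Real.exp (ζ.2.2.1 * numDot β ζ.1 + ζ.2.2.1 * catDot β z + ζ.2.2.1 * β.1)) -
        (lam * catDist p z ζ.2.1 + lam * κ) := by
  obtain ⟨x, z', y'⟩ := ζ
  simp only [logLoss, groundDist, label_eq_neg_of_ne hy]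
  congr 1
  · ring_nf
  · simp only [sub_self, map_zero, if_pos (Ne.symm hy)]
    ring

/-- With two labels, `y` is either `yⁱ`, giving the `+` constraints, or its negative, giving the `-`
constraints with the extra `λ κ`. -/
theorem exists_feasible_iff (nrm : Seminorm ℝ (Fin n → ℝ)) (κ p : ℝ) (ξ : Fin N → Sample n k)
    (β : Coef n k) (lam : ℝ) (s : Fin N → ℝ) :
    (∃ up vp um vm, Feasible nrm κ p ξ (β, lam, s, up, vp, um, vm)) ↔
      EpigraphFeasible nrm κ p ξ β lam s := by
  simp only [Feasible, mem_expCone_one_iff, EpigraphFeasible]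
  constructor
  · rintro ⟨up, vp, um, vm, hp, hm, hd, h0⟩
    refine ⟨hd, h0, fun i z y => ?_⟩
    by_cases hy : (ξ i).2.2 = y
    · subst hy
      rw [logLoss_sub_groundDist_same, ← exists_add_le_one_iff]
      exact ⟨_, _, hp i z⟩
    · rw [logLoss_sub_groundDist_flip _ _ _ _ _ _ _ hy, ← exists_add_le_one_iff]
      simp only [← sub_sub]
      exact ⟨_, _, hm i z⟩
  · rintro ⟨hd, h0, h⟩
    have hp : ∀ i z, ∃ u v : ℝ, _ := fun i z => by
      have h1 := h i z (ξ i).2.2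
      rw [logLoss_sub_groundDist_same, ← exists_add_le_one_iff] at h1
      exact h1
    have hm : ∀ i z, ∃ u v : ℝ, _ := fun i z => by
      obtain ⟨y, -, hy⟩ := exists_label_neg (ξ i).2.2
      have h1 := h i z y
      rw [logLoss_sub_groundDist_flip _ _ _ _ _ _ _ hy, ← exists_add_le_one_iff] at h1
      simp only [← sub_sub] at h1
      exact h1
    choose up vp hp using hp
    choose um vm hm using hm
    exact ⟨up, vp, um, vm, hp, hm, hd, h0⟩

theorem exists_epigraphFeasible (nrm : Seminorm ℝ (Fin n → ℝ)) {κ : ℝ} (hκ : 0 < κ) (p : ℝ)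
    (ξ : Fin N → Sample n k) (β : Coef n k) : ∃ lam s, EpigraphFeasible nrm κ p ξ β lam s := by
  refine ⟨max (dualNorm nrm β.2.1) 0, fun i => ∑ c : Cat k × Label, logLoss β ((ξ i).1, c.1, c.2),
    le_max_left _ _, le_max_right _ _, fun i z y => ?_⟩
  refine (sub_le_self _ (mul_nonneg (le_max_right _ _) (groundDist_nonneg nrm hκ p _ _))).trans ?_
  exact Finset.single_le_sum (f := fun c : Cat k × Label => logLoss β ((ξ i).1, c.1, c.2))
    (fun c _ => logLoss_nonneg β _) (Finset.mem_univ (z, y))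

theorem worstCase_le_of_epigraphFeasible (hN : 0 < N) (nrm : Seminorm ℝ (Fin n → ℝ))
    (hnrm : ∀ x, nrm x = 0 → x = 0) {κ p : ℝ} (hp : 0 < p) {ε : ℝ}
    (hε : 0 < ε) (ξ : Fin N → Sample n k) {β : Coef n k} {lam : ℝ} {s : Fin N → ℝ}
    (h : EpigraphFeasible nrm κ p ξ β lam s) :
    worstCase nrm κ p ε ξ β ≤ ENNReal.ofReal (lam * ε + 1 / (N : ℝ) * ∑ i, s i) := by
  obtain ⟨hd, h0, hs⟩ := h
  have hs0 : ∀ i, 0 ≤ s i := fun i => by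
    have h1 := hs i (ξ i).2.1 (ξ i).2.2
    have h2 := groundDist_self nrm κ hp (ξ i)
    have h3 := logLoss_nonneg β (ξ i)
    change logLoss β (ξ i) - lam * groundDist nrm κ p (ξ i) (ξ i) ≤ s i at h1
    rw [h2] at h1
    linarith
  -- The best response that leaves the numerical features in place; the Lipschitz bound absorbs any
  -- shift in them.
  set φ : Sample n k → ℝ≥0∞ := fun ζ => ⨆ c : Cat k × Label, ENNReal.ofReal
    (logLoss β (ζ.1, c.1, c.2) - lam * groundDist nrm κ p (ζ.1, c.1, c.2) ζ) with hφdef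
  have hφ : Measurable φ := by
    refine Measurable.iSup fun c => ENNReal.measurable_ofReal.comp ?_
    refine measurable_of_measurable_left fun z y => ?_
    simp only [groundDist, sub_self]
    exact (continuous_logLoss_left β _ _).measurable.sub measurable_const
  refine iSup₂_le fun Q hQ => ?_
  refine (lintegral_le_of_mem_ambiguitySet (groundDist nrm κ p) ξ ε lam h0 _ φ hφ ?_ hQ).trans ?_
  · rintro ⟨x, z, y⟩ ⟨x', z', y'⟩
    rw [← ENNReal.ofReal_mul h0]
    refine (ENNReal.ofReal_le_ofReal ?_).trans (ENNReal.ofReal_add_le.trans (add_le_add_left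
      (le_iSup (fun c : Cat k × Label => ENNReal.ofReal (logLoss β (x', c.1, c.2) -
        lam * groundDist nrm κ p (x', c.1, c.2) (x', z', y'))) (z, y)) _))
    have := logLoss_le_add nrm hnrm β h0 hd x x' z y
    simp only [groundDist, sub_self, map_zero]
    linarith
  · rw [ENNReal.ofReal_add (by positivity)
      (mul_nonneg (by positivity) (Finset.sum_nonneg fun i _ => hs0 i)), ENNReal.ofReal_mul h0,
      add_comm, ENNReal.ofReal_mul (by positivity), one_div,
      ENNReal.ofReal_inv_of_pos (by exact_mod_cast hN), ENNReal.ofReal_natCast,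
      ENNReal.ofReal_sum_of_nonneg fun i _ => hs0 i]
    gcongr with i
    exact iSup_le fun c => ENNReal.ofReal_le_ofReal (hs i c.1 c.2)

/-- A linear growth bound along every ray forces `‖β_N‖_* ≤ λ`. -/
theorem dualNorm_le_of_logLoss_le (nrm : Seminorm ℝ (Fin n → ℝ))
    (hnrm : ∀ x, nrm x = 0 → x = 0) (β : Coef n k) {lam : ℝ} (hlam : 0 ≤ lam)
    (x : Fin n → ℝ) (z : Cat k) (y : Label) (C : ℝ)
    (h : ∀ w, logLoss β (x + w, z, y) ≤ C + lam * nrm w) : dualNorm nrm β.2.1 ≤ lam := by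
  rw [dualNorm_le_iff nrm hnrm _ _ hlam]
  have hadd : ∀ w, numDot β (x + w) = numDot β x + numDot β w := fun w => by
    simp [numDot, mul_add, Finset.sum_add_distrib]
  have hsmul : ∀ (t : ℝ) w, numDot β (t • w) = t * numDot β w := fun t w => by
    simp [numDot, Finset.mul_sum, mul_left_comm]
  have key : ∀ w, -y.1 * numDot β w ≤ lam * nrm w := fun w => by
    by_contra! hlt
    set D := C + y.1 * (β.1 + numDot β x + catDot β z) with hD
    -- The loss dominates its exponent, which is affine in `t` along the ray.
    have hb : ∀ t : ℝ, 0 ≤ t → t * (-y.1 * numDot β w - lam * nrm w) ≤ D := fun t ht => by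
      have h1 := (le_log_one_add_exp _).trans (h (t • w))
      rw [hadd, hsmul, map_smul_eq_mul, Real.norm_of_nonneg ht] at h1
      rw [hD]
      linarith
    have hpos : 0 < -y.1 * numDot β w - lam * nrm w := sub_pos.2 hlt
    have := hb ((|D| + 1) / (-y.1 * numDot β w - lam * nrm w)) (by positivity)
    rw [div_mul_cancel₀ _ hpos.ne'] at this
    linarith [le_abs_self D]
  intro w
  change numDot β w ≤ _
  rcases label_eq y with hy | hy
  · have := key w
    rw [hy] at this
    linarith
  · have h1 := key (-w)
    have h2 := hsmul (-1) w
    rw [neg_one_smul] at h2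
    rw [hy, map_neg_eq_map, h2] at h1
    linarith

/-- Strong duality with dual attainment. -/
theorem exists_epigraphFeasible_objective_le (hN : 0 < N) (nrm : Seminorm ℝ (Fin n → ℝ))
    (hnrm : ∀ x, nrm x = 0 → x = 0) {κ : ℝ} (hκ : 0 < κ) {p : ℝ} (hp : 0 < p) {ε : ℝ}
    (hε : 0 < ε) (ξ : Fin N → Sample n k) (β : Coef n k) {M : ℝ} (hM : 0 ≤ M)
    (hworst : worstCase nrm κ p ε ξ β ≤ ENNReal.ofReal M) :
    ∃ lam s, EpigraphFeasible nrm κ p ξ β lam s ∧ lam * ε + 1 / (N : ℝ) * ∑ i, s i ≤ M := by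
  have hNr : (0 : ℝ) < N := by exact_mod_cast hN
  set d := groundDist (k := k) nrm κ p with hd
  have hd0 : ∀ ζ ζ', 0 ≤ d ζ ζ' := groundDist_nonneg nrm hκ p
  have hds : ∀ ζ, d ζ ζ = 0 := groundDist_self nrm κ hp
  have hl0 := logLoss_nonneg β
  obtain ⟨lam, hlam, hsup⟩ := exists_supporting_slope
    (Set.range fun c : Fin N → Sample n k =>
      (1 / (N : ℝ) * ∑ i, d (c i) (ξ i), 1 / (N : ℝ) * ∑ i, logLoss β (c i))) ε M
    (by
      rintro _ ⟨a, rfl⟩ _ ⟨b, rfl⟩ θ h0 h1 hcost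
      have hmem := mixture_mem_ambiguitySet hN d hd0 ξ a b ε θ h0 h1 hcost
      have h2 := (le_iSup₂ (f := fun Q (_ : Q ∈ ambiguitySet d (empirical ξ) ε) =>
        ∫⁻ ζ, ENNReal.ofReal (logLoss β ζ) ∂Q) _ hmem).trans hworst
      have hs : ∀ c : Fin N → Sample n k, 0 ≤ 1 / (N : ℝ) * ∑ i, logLoss β (c i) := fun c =>
        mul_nonneg (by positivity) (Finset.sum_nonneg fun i _ => hl0 _)
      rw [lintegral_add_measure, lintegral_smul_measure, lintegral_smul_measure,
        lintegral_empirical_ofReal hN _ _ hl0, lintegral_empirical_ofReal hN _ _ hl0,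
        smul_eq_mul, smul_eq_mul, ← ENNReal.ofReal_mul (by linarith), ← ENNReal.ofReal_mul h0,
        ← ENNReal.ofReal_add (mul_nonneg (by linarith) (hs a)) (mul_nonneg h0 (hs b)),
        ENNReal.ofReal_le_ofReal_iff hM] at h2
      exact h2)
    -- The unmoved data set is the Slater point: its cost is `0 < ε`.
    ⟨_, ⟨ξ, rfl⟩, by simpa [hds] using hε⟩
  have hsel : ∀ c : Fin N → Sample n k,
      ∑ i, (logLoss β (c i) - lam * d (c i) (ξ i)) ≤ N * (M - lam * ε) := fun c => by
    have h1 := hsup _ ⟨c, rfl⟩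
    simp only [one_div] at h1
    rw [Finset.sum_sub_distrib, ← Finset.mul_sum]
    have h2 : (∑ i, logLoss β (c i)) = N * ((N : ℝ)⁻¹ * ∑ i, logLoss β (c i)) := by field_simp
    have h3 : (∑ i, d (c i) (ξ i)) = N * ((N : ℝ)⁻¹ * ∑ i, d (c i) (ξ i)) := by field_simp
    rw [h2, h3]
    have := mul_le_mul_of_nonneg_left h1 hNr.le
    linarith
  have hbdd := bddAbove_of_sum_le (fun i ζ => logLoss β ζ - lam * d ζ (ξ i)) _ hsel ξ
  have hle : ∀ i ζ, logLoss β ζ - lam * d ζ (ξ i) ≤ ⨆ ζ, logLoss β ζ - lam * d ζ (ξ i) :=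
    fun i ζ => le_ciSup (hbdd i) ζ
  have : Nonempty (Sample n k) := ⟨ξ ⟨0, hN⟩⟩
  -- The supremum runs over the whole sample space, not only `x = xⁱ`; this extra range yields the
  -- dual-norm constraint.
  refine ⟨lam, fun i => ⨆ ζ, logLoss β ζ - lam * d ζ (ξ i),
    ⟨?_, hlam, fun i z y => hle i (_, z, y)⟩, ?_⟩
  · refine dualNorm_le_of_logLoss_le nrm hnrm β hlam (ξ ⟨0, hN⟩).1 (ξ ⟨0, hN⟩).2.1
      (ξ ⟨0, hN⟩).2.2 (⨆ ζ, logLoss β ζ - lam * d ζ (ξ ⟨0, hN⟩)) fun w => ?_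
    have h1 := hle ⟨0, hN⟩ ((ξ ⟨0, hN⟩).1 + w, (ξ ⟨0, hN⟩).2.1, (ξ ⟨0, hN⟩).2.2)
    have h2 : d ((ξ ⟨0, hN⟩).1 + w, (ξ ⟨0, hN⟩).2.1, (ξ ⟨0, hN⟩).2.2) (ξ ⟨0, hN⟩) = nrm w := by
      generalize ξ ⟨0, hN⟩ = ζ
      obtain ⟨x, z, y⟩ := ζ
      simp [hd, groundDist, catDist_self hp]
    rw [h2] at h1
    linarith
  · have h1 := sum_ciSup_le (fun i ζ => logLoss β ζ - lam * d ζ (ξ i)) _ hsel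
    have h2 := mul_le_mul_of_nonneg_left h1 (one_div_nonneg.2 hNr.le)
    rw [one_div, inv_mul_cancel_left₀ hNr.ne'] at h2
    rw [one_div]
    linarith

/-- Weak duality at any feasible point makes the worst case finite, so strong duality can be applied
with `M` equal to it; weak duality then turns the resulting inequality into equality. -/
theorem isLeast_worstCase (hN : 0 < N) (nrm : Seminorm ℝ (Fin n → ℝ))
    (hnrm : ∀ x, nrm x = 0 → x = 0) {κ : ℝ} (hκ : 0 < κ) {p : ℝ} (hp : 0 < p) {ε : ℝ}
    (hε : 0 < ε) (ξ : Fin N → Sample n k) (β : Coef n k) :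
    IsLeast {r : EReal | ∃ D : Decision n k N, Feasible nrm κ p ξ D ∧ D.1 = β ∧
        r = ((objective ε D : ℝ) : EReal)} ((worstCase nrm κ p ε ξ β : ENNReal) : EReal) := by
  have hweak : ∀ lam s, EpigraphFeasible nrm κ p ξ β lam s →
      (worstCase nrm κ p ε ξ β).toReal ≤ lam * ε + 1 / (N : ℝ) * ∑ i, s i := fun lam s h => by
    have h1 := worstCase_le_of_epigraphFeasible hN nrm hnrm hp hε ξ h
    have hs0 : 0 ≤ lam * ε + 1 / (N : ℝ) * ∑ i, s i := by
      refine add_nonneg (mul_nonneg h.2.1 hε.le) (mul_nonneg (by positivity)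
        (Finset.sum_nonneg fun i _ => ?_))
      have h2 := h.2.2 i (ξ i).2.1 (ξ i).2.2
      change logLoss β (ξ i) - lam * groundDist nrm κ p (ξ i) (ξ i) ≤ s i at h2
      rw [groundDist_self nrm κ hp] at h2
      linarith [logLoss_nonneg β (ξ i)]
    exact ENNReal.toReal_le_of_le_ofReal hs0 h1
  have hfin : worstCase nrm κ p ε ξ β ≠ ⊤ := by
    obtain ⟨lam, s, h⟩ := exists_epigraphFeasible nrm hκ p ξ β
    exact ne_top_of_le_ne_top ENNReal.ofReal_ne_top
      (worstCase_le_of_epigraphFeasible hN nrm hnrm hp hε ξ h)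
  have hcoe : ((worstCase nrm κ p ε ξ β : ENNReal) : EReal) =
      (((worstCase nrm κ p ε ξ β).toReal : ℝ) : EReal) := (EReal.coe_ennreal_toReal hfin).symm
  rw [hcoe]
  constructor
  · obtain ⟨lam, s, h, hle⟩ := exists_epigraphFeasible_objective_le hN nrm hnrm hκ hp hε ξ β
      ENNReal.toReal_nonneg (ENNReal.ofReal_toReal hfin).ge
    obtain ⟨up, vp, um, vm, hD⟩ := (exists_feasible_iff nrm κ p ξ β lam s).2 h
    exact ⟨_, hD, rfl, EReal.coe_eq_coe_iff.2 (le_antisymm (hweak lam s h) hle)⟩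
  · rintro _ ⟨⟨β', lam, s, up, vp, um, vm⟩, hD, rfl, rfl⟩
    exact EReal.coe_le_coe_iff.2
      (hweak lam s ((exists_feasible_iff nrm κ p ξ _ lam s).1 ⟨up, vp, um, vm, hD⟩))

end MixedLogReg

/-! ### The reformulation as a conic program. -/

namespace MixedLogReg

section ConicProgram

variable {n m N : ℕ} {k : Fin m → ℕ}

theorem isLinearMap_numDot (x : Fin n → ℝ) :
    IsLinearMap ℝ fun D : Decision n k N => numDot D.1 x := by
  constructor
  · intro a b
    simp [numDot, add_mul, Finset.sum_add_distrib]
  · intro c a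
    simp [numDot, Finset.mul_sum, mul_assoc]

theorem isLinearMap_catDot (z : Cat k) :
    IsLinearMap ℝ fun D : Decision n k N => catDot D.1 z := by
  constructor
  · intro a b
    simp [catDot, add_mul, Finset.sum_add_distrib]
  · intro c a
    simp [catDot, Finset.mul_sum, mul_assoc]

/-- The affine map `x ↦ (u x, 1, v x)`. -/
noncomputable def homogenized {V : Type} [AddCommGroup V] [Module ℝ V] (u v : V →ₗ[ℝ] ℝ) :
    V →ᵃ[ℝ] ℝ × ℝ × ℝ :=
  (u.prod ((0 : V →ₗ[ℝ] ℝ).prod v)).toAffineMap + AffineMap.const ℝ V (0, 1, 0)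

theorem homogenized_apply {V : Type} [AddCommGroup V] [Module ℝ V] (u v : V →ₗ[ℝ] ℝ) (x : V) :
    homogenized u v x = (u x, 1, v x) := by
  simp [homogenized]

/-- The argument of the exponential-cone constraint attached to `σ (β₀ + β_Nᵀ x + β_Cᵀ z)` with
transport cost `δ`, for sample `i`. -/
noncomputable def coneArg (i : Fin N) (x : Fin n → ℝ) (z : Cat k) (σ δ : ℝ) :
    Decision n k N →ₗ[ℝ] ℝ :=
  IsLinearMap.mk' (fun D => σ * (D.1.1 + numDot D.1 x + catDot D.1 z) - D.2.2.1 i - D.2.1 * δ) <| by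
    constructor
    · intro a b
      have h1 := (isLinearMap_numDot (k := k) (N := N) x).map_add a b
      have h2 := (isLinearMap_catDot (n := n) (N := N) z).map_add a b
      rw [h1, h2]
      simp only [Prod.fst_add, Prod.snd_add, Pi.add_apply]
      ring
    · intro c a
      have h1 := (isLinearMap_numDot (k := k) (N := N) x).map_smul c a
      have h2 := (isLinearMap_catDot (n := n) (N := N) z).map_smul c a
      rw [h1, h2]
      simp only [Prod.smul_fst, Prod.smul_snd, Pi.smul_apply, smul_eq_mul]
      ring

theorem coneArg_apply (i : Fin N) (x : Fin n → ℝ) (z : Cat k) (σ δ : ℝ) (D : Decision n k N) :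
    coneArg i x z σ δ D =
      σ * (D.1.1 + numDot D.1 x + catDot D.1 z) - D.2.2.1 i - D.2.1 * δ := rfl

theorem isExpConicProgram (nrm : Seminorm ℝ (Fin n → ℝ)) (κ p ε : ℝ) (ξ : Fin N → Sample n k) :
    IsExpConicProgram nrm (objective ε) {D : Decision n k N | Feasible nrm κ p ξ D} := by
  let lin (f : Decision n k N → ℝ) (hf : IsLinearMap ℝ f) : Decision n k N →ₗ[ℝ] ℝ := hf.mk' f
  let up (i : Fin N) (z : Cat k) := lin (fun D => D.2.2.2.1 i z) ⟨fun _ _ => rfl, fun _ _ => rfl⟩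
  let vp (i : Fin N) (z : Cat k) := lin (fun D => D.2.2.2.2.1 i z) ⟨fun _ _ => rfl, fun _ _ => rfl⟩
  let um (i : Fin N) (z : Cat k) :=
    lin (fun D => D.2.2.2.2.2.1 i z) ⟨fun _ _ => rfl, fun _ _ => rfl⟩
  let vm (i : Fin N) (z : Cat k) :=
    lin (fun D => D.2.2.2.2.2.2 i z) ⟨fun _ _ => rfl, fun _ _ => rfl⟩
  let lam := lin (fun D => D.2.1) ⟨fun _ _ => rfl, fun _ _ => rfl⟩
  let β : Decision n k N →ₗ[ℝ] (Fin n → ℝ) :=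
    IsLinearMap.mk' (fun D => D.1.2.1) ⟨fun _ _ => rfl, fun _ _ => rfl⟩
  let cone (i : Fin N) (z : Cat k) (σ c : ℝ) :=
    coneArg i (ξ i).1 z (σ * (ξ i).2.2.1) (catDist p z (ξ i).2.1 + c)
  -- The index `none` carries `0 ≤ λ`. The first Boolean of a cone index selects kept or flipped
  -- label, the second `u` or `v`; the sign `0` removes the `β` term for `u`.
  refine ⟨inferInstance, ⟨lin (objective ε) ?_, fun _ => rfl⟩,
    Option ((Fin N × Cat k) × Bool), (Fin N × Cat k) × (Bool × Bool), inferInstance, inferInstance,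
    fun r => match r with
      | none => (-lam).toAffineMap
      | some (c, true) => (up c.1 c.2 + vp c.1 c.2).toAffineMap - AffineMap.const ℝ _ 1
      | some (c, false) => (um c.1 c.2 + vm c.1 c.2).toAffineMap - AffineMap.const ℝ _ 1,
    fun r => match r with
      | (c, true, true) => homogenized (up c.1 c.2) (cone c.1 c.2 0 0)
      | (c, true, false) => homogenized (vp c.1 c.2) (cone c.1 c.2 (-1) 0)
      | (c, false, true) => homogenized (um c.1 c.2) (cone c.1 c.2 0 κ)
      | (c, false, false) => homogenized (vm c.1 c.2) (cone c.1 c.2 1 κ),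
    β, lam, ?_⟩
  · constructor
    · rintro ⟨-, l, s, -⟩ ⟨-, l', s', -⟩
      simp only [objective, Pi.add_apply, Finset.sum_add_distrib]
      ring
    · rintro c ⟨-, l, s, -⟩
      simp only [objective, Prod.smul_mk, Pi.smul_apply, smul_eq_mul, ← Finset.mul_sum]
      ring
  · ext ⟨b, l, s, u, v, u', v'⟩
    simp only [Set.mem_ofPred_eq, Feasible, Option.forall, Prod.forall, Bool.forall_bool,
      homogenized_apply, cone, coneArg_apply]
    simp only [AffineMap.coe_sub, Pi.sub_apply, LinearMap.coe_toAffineMap, LinearMap.neg_apply,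
      LinearMap.add_apply, AffineMap.const_apply, up, vp, um, vm, lam, β, lin,
      IsLinearMap.mk'_apply, sub_nonpos, Left.neg_nonpos_iff, zero_mul, add_zero, neg_one_mul,
      one_mul, zero_sub]
    have e1 : ∀ i z, -(ξ i).2.2.1 * numDot b (ξ i).1 - (ξ i).2.2.1 * catDot b z -
        (ξ i).2.2.1 * b.1 - s i - l * catDist p z (ξ i).2.1 =
        -(ξ i).2.2.1 * (b.1 + numDot b (ξ i).1 + catDot b z) - s i -
          l * catDist p z (ξ i).2.1 := fun i z => by ring
    have e2 : ∀ i z, (ξ i).2.2.1 * numDot b (ξ i).1 + (ξ i).2.2.1 * catDot b z +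
        (ξ i).2.2.1 * b.1 - s i - l * catDist p z (ξ i).2.1 - l * κ =
        (ξ i).2.2.1 * (b.1 + numDot b (ξ i).1 + catDot b z) - s i -
          l * (catDist p z (ξ i).2.1 + κ) := fun i z => by ring
    have e3 : ∀ i z, -s i - l * catDist p z (ξ i).2.1 - l * κ =
        -s i - l * (catDist p z (ξ i).2.1 + κ) := fun i z => by ring
    simp only [e1, e2, e3]
    constructor
    · rintro ⟨h1, h2, h3, h4⟩
      exact ⟨⟨h4, fun i z => ⟨(h2 i z).1, (h1 i z).1⟩⟩,
        fun i z => ⟨⟨(h2 i z).2.2, (h2 i z).2.1⟩, (h1 i z).2.2, (h1 i z).2.1⟩, h3⟩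
    · rintro ⟨⟨h4, h1⟩, h2, h3⟩
      exact ⟨fun i z => ⟨(h1 i z).2, (h2 i z).2.2, (h2 i z).2.1⟩,
        fun i z => ⟨(h1 i z).1, (h2 i z).1.2, (h2 i z).1.1⟩, h3, h4⟩

end ConicProgram

end MixedLogReg

/-! ### The equivalence of the two problems. -/

theorem theorem1 {n m N : ℕ} (hN : 0 < N)
    (k : Fin m → ℕ) (hk : ∀ j, 2 ≤ k j)
    (nrm : Seminorm ℝ (Fin n → ℝ)) (hnrm : ∀ x, nrm x = 0 → x = 0)
    (κ : ℝ) (hκ : 0 < κ) (p : ℝ) (hp : 0 < p) (ε : ℝ) (hε : 0 < ε)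
    (ξ : Fin N → MixedLogReg.Sample n k) :
    -- the two problems have the same optimal value
    (⨅ β : MixedLogReg.Coef n k, ((MixedLogReg.worstCase nrm κ p ε ξ β : ENNReal) : EReal)) =
      (⨅ (D : MixedLogReg.Decision n k N) (_ : MixedLogReg.Feasible nrm κ p ξ D),
        ((MixedLogReg.objective ε D : ℝ) : EReal)) ∧
    -- for each fixed `β` the worst-case expected loss is the minimum, attained, of the program
    -- over its remaining variables
    (∀ β : MixedLogReg.Coef n k,
      IsLeast
        {r : EReal | ∃ D : MixedLogReg.Decision n k N,
          MixedLogReg.Feasible nrm κ p ξ D ∧ D.1 = β ∧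
            r = ((MixedLogReg.objective ε D : ℝ) : EReal)}
        ((MixedLogReg.worstCase nrm κ p ε ξ β : ENNReal) : EReal)) ∧
    -- the minimizers `β` are the `β`-components of the minimizers of the program
    (∀ β : MixedLogReg.Coef n k,
      (∀ β' : MixedLogReg.Coef n k,
        MixedLogReg.worstCase nrm κ p ε ξ β ≤ MixedLogReg.worstCase nrm κ p ε ξ β') ↔
      ∃ D : MixedLogReg.Decision n k N, MixedLogReg.Feasible nrm κ p ξ D ∧ D.1 = β ∧
        ∀ D' : MixedLogReg.Decision n k N, MixedLogReg.Feasible nrm κ p ξ D' →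
          MixedLogReg.objective ε D ≤ MixedLogReg.objective ε D') ∧
    -- the reformulation is a finite-dimensional exponential conic program
    MixedLogReg.IsExpConicProgram nrm (MixedLogReg.objective ε)
      {D : MixedLogReg.Decision n k N | MixedLogReg.Feasible nrm κ p ξ D} := by
  -- Attained partial minimization over the variables other than `β` yields the equality of values
  -- and the correspondence of minimizers.
  have hleast := MixedLogReg.isLeast_worstCase hN nrm hnrm hκ hp hε ξ
  refine ⟨le_antisymm ?_ ?_, hleast, fun β => ⟨fun hβ => ?_, ?_⟩,
    MixedLogReg.isExpConicProgram nrm κ p ε ξ⟩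
  · exact le_iInf₂ fun D hD => (iInf_le _ D.1).trans ((hleast D.1).2 ⟨D, hD, rfl, rfl⟩)
  · refine le_iInf fun β => ?_
    obtain ⟨D, hD, -, h⟩ := (hleast β).1
    exact (iInf₂_le D hD).trans h.ge
  · obtain ⟨D, hD, rfl, h⟩ := (hleast β).1
    refine ⟨D, hD, rfl, fun D' hD' => ?_⟩
    rw [← EReal.coe_le_coe_iff, ← h]
    exact (EReal.coe_ennreal_le_coe_ennreal_iff.2 (hβ D'.1)).trans
      ((hleast D'.1).2 ⟨D', hD', rfl, rfl⟩)
  · rintro ⟨D, hD, rfl, h⟩ β'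
    obtain ⟨D', hD', -, h'⟩ := (hleast β').1
    rw [← EReal.coe_ennreal_le_coe_ennreal_iff, h']
    exact ((hleast D.1).2 ⟨D, hD, rfl, rfl⟩).trans (EReal.coe_le_coe_iff.2 (h D' hD'))
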